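/- Let $N, M \ge 1$ be integers and let $\gamma, \lambda_x, \lambda_v, \lambda_w > 0$ be arbitrary positive constants. For $y, z \in \mathbb{R}^M$ put $\phi(y,z) = (1+|y-z|^2)^{-\gamma/2}$, where $|\cdot|$ is the Euclidean norm. Let $\hat x_i, \hat v_i : [0,\infty) \to \mathbb{R}^M$ $(1 \le i \le N)$ be a solution, with arbitrary initial data $\{\hat x_i(0), \hat v_i(0)\}_{i=1}^N$, of the centralized herding model $$\frac{d\hat x_i}{dt} = \hat v_i, \qquad \frac{d\hat v_i}{dt} = \frac{\lambda_x}{N}\sum_{j=1}^N \phi(\hat x_i,\hat x_j)(\hat x_j-\hat x_i) + \frac{\lambda_v}{N}\sum_{j=1}^N \phi(\hat x_i,\hat x_j)(\hat v_j-\hat v_i) - \lambda_w \hat x_i .$$ Then the herding phenomena occurs: for all $1 \le i, j \le N$, $$\lim_{t\to\infty} |\hat x_i(t)-\hat x_j(t)| = 0 \quad\text{and}\quad \lim_{t\to\infty} |\hat v_i(t)-\hat v_j(t)| = 0 .$$ -/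

import Mathlib

open Filter Topology

namespace HerdingModel

/-- The communication rate `φ(y, z) = 1 / (1 + |y - z|²)^(γ/2)` between players at the
positions `y, z ∈ ℝᴹ`, where `|·|` is the Euclidean norm. -/
noncomputable def commRate {M : ℕ} (γ : ℝ) (y z : EuclideanSpace ℝ (Fin M)) : ℝ :=
  1 / (1 + ‖y - z‖ ^ 2) ^ (γ / 2)

/-- The right-hand side of the equation for `v̂ᵢ` in the centralized herding model with `N`
players and `M` assets, at the configuration `(x, v)`. -/
noncomputable def centralizedForce {N M : ℕ} (γ lx lv lw : ℝ)
    (x v : Fin N → EuclideanSpace ℝ (Fin M)) (i : Fin N) : EuclideanSpace ℝ (Fin M) :=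
  (lx / (N : ℝ)) • ∑ j, commRate γ (x i) (x j) • (x j - x i)
    + (lv / (N : ℝ)) • ∑ j, commRate γ (x i) (x j) • (v j - v i)
    - lw • x i

/-- `(x, v)` is a solution of the centralized herding model on the time interval `[0, ∞)`
(with the one-sided derivative at the initial time). Values at negative times are irrelevant. -/
structure IsCentralizedSolution {N M : ℕ} (γ lx lv lw : ℝ)
    (x v : ℝ → Fin N → EuclideanSpace ℝ (Fin M)) : Prop where
  position : ∀ t : ℝ, 0 ≤ t → ∀ i,
    HasDerivWithinAt (fun s => x s i) (v t i) (Set.Ici 0) t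
  velocity : ∀ t : ℝ, 0 ≤ t → ∀ i,
    HasDerivWithinAt (fun s => v s i) (centralizedForce γ lx lv lw (x t) (v t) i) (Set.Ici 0) t

/-- The herding phenomena: all the mutual distances of the positions and of the velocities
tend to zero as time tends to infinity. -/
def HerdingOccurs {N M : ℕ} (x v : ℝ → Fin N → EuclideanSpace ℝ (Fin M)) : Prop :=
  ∀ i j, Tendsto (fun t => ‖x t i - x t j‖) atTop (𝓝 0) ∧
    Tendsto (fun t => ‖v t i - v t j‖) atTop (𝓝 0)

end HerdingModel

/-!
The proof is a Lyapunov argument carried out entirely on the differences `xᵢ - xⱼ`, `vᵢ - vⱼ`.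

The position coupling is the gradient of a potential: if `Ψ` is the primitive of
`u ↦ (1 + u) ^ (-γ / 2)` with `Ψ 0 = 0`, then, summing over ordered pairs, the energy
`E = ∑ |vᵢ - vⱼ|² + lx ∑ Ψ (|xᵢ - xⱼ|²) + lw ∑ |xᵢ - xⱼ|²` satisfies
`E' = -2 lv ∑ φᵢⱼ |vᵢ - vⱼ|²` (`hasDerivWithinAt_energy`), because the pairwise forces cancel in the
mean (`pairInner_centralizedForce`). Since `lw > 0`, the bound on `E` bounds all mutual distances,
so the communication rates stay above some `c > 0` (`exists_pos_le_commRate`), however large `γ` is.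

The energy dissipates only the velocity differences. Adding the cross term
`ε ∑ ⟪xᵢ - xⱼ, vᵢ - vⱼ⟫`, whose derivative (`hasDerivWithinAt_cross`) contains
`-lw ∑ |xᵢ - xⱼ|²`, gives for small `ε` a function `L` comparable to
`∑ |xᵢ - xⱼ|² + ∑ |vᵢ - vⱼ|²` with `L' ≤ -κ L`. Hence `L` decays exponentially
(`le_mul_exp_of_hasDerivWithinAt_le`).
-/

namespace HerdingModel

open scoped InnerProductSpace

/-! ### The communication rate and its potential -/

/-- The communication rate as a function of the squared distance. The absolute value changes
nothing for squared distances and makes the function continuous on all of `ℝ`. -/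
noncomputable def rateProfile (γ u : ℝ) : ℝ := 1 / (1 + |u|) ^ (γ / 2)

/-- The primitive of `rateProfile` vanishing at `0`, the interaction potential as a function of
the squared distance. -/
noncomputable def ratePotential (γ s : ℝ) : ℝ := ∫ u in (0 : ℝ)..s, rateProfile γ u

lemma continuous_rateProfile (γ : ℝ) : Continuous (rateProfile γ) := by
  have h : ∀ u : ℝ, 0 < 1 + |u| := fun u => by positivity
  unfold rateProfile
  refine Continuous.div continuous_const ?_ fun u => (Real.rpow_pos_of_pos (h u) _).ne'
  exact (continuous_const.add continuous_abs).rpow_const fun u => Or.inl (h u).ne'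

lemma rateProfile_pos (γ u : ℝ) : 0 < rateProfile γ u := by
  unfold rateProfile
  positivity

lemma rateProfile_le_one {γ : ℝ} (hγ : 0 ≤ γ) (u : ℝ) : rateProfile γ u ≤ 1 := by
  unfold rateProfile
  have h : 1 ≤ (1 + |u|) ^ (γ / 2) :=
    Real.one_le_rpow (by linarith [abs_nonneg u]) (by linarith)
  exact (div_le_one (by linarith)).2 h

lemma hasDerivAt_ratePotential (γ s : ℝ) :
    HasDerivAt (ratePotential γ) (rateProfile γ s) s :=
  intervalIntegral.integral_hasDerivAt_right
    ((continuous_rateProfile γ).intervalIntegrable _ _)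
    (continuous_rateProfile γ).aestronglyMeasurable.stronglyMeasurableAtFilter
    (continuous_rateProfile γ).continuousAt

lemma ratePotential_nonneg (γ : ℝ) {s : ℝ} (hs : 0 ≤ s) : 0 ≤ ratePotential γ s :=
  intervalIntegral.integral_nonneg hs fun u _ => (rateProfile_pos γ u).le

lemma ratePotential_le {γ : ℝ} (hγ : 0 ≤ γ) {s : ℝ} (hs : 0 ≤ s) : ratePotential γ s ≤ s := by
  have h := intervalIntegral.integral_mono_on (μ := MeasureTheory.volume) hs
    ((continuous_rateProfile γ).intervalIntegrable 0 s)
    (continuous_const.intervalIntegrable 0 s) fun u _ => rateProfile_le_one hγ u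
  simpa [ratePotential] using h

variable {N M : ℕ}

lemma commRate_eq_rateProfile (γ : ℝ) (y z : EuclideanSpace ℝ (Fin M)) :
    commRate γ y z = rateProfile γ (‖y - z‖ ^ 2) := by
  simp [commRate, rateProfile]

lemma commRate_symm (γ : ℝ) (y z : EuclideanSpace ℝ (Fin M)) :
    commRate γ y z = commRate γ z y := by
  simp only [commRate, norm_sub_rev y z]

lemma commRate_pos (γ : ℝ) (y z : EuclideanSpace ℝ (Fin M)) : 0 < commRate γ y z :=
  commRate_eq_rateProfile γ y z ▸ rateProfile_pos _ _

lemma commRate_le_one {γ : ℝ} (hγ : 0 ≤ γ) (y z : EuclideanSpace ℝ (Fin M)) :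
    commRate γ y z ≤ 1 :=
  commRate_eq_rateProfile γ y z ▸ rateProfile_le_one hγ _

/-- Points at bounded distance communicate at a rate bounded away from zero. -/
lemma exists_pos_le_commRate {γ : ℝ} (hγ : 0 ≤ γ) {R : ℝ} (hR : 0 ≤ R) :
    ∃ c, 0 < c ∧ ∀ y z : EuclideanSpace ℝ (Fin M), ‖y - z‖ ^ 2 ≤ R → c ≤ commRate γ y z := by
  refine ⟨1 / (1 + R) ^ (γ / 2), by positivity, fun y z h => ?_⟩
  unfold commRate
  gcongr

/-! ### Sums over pairs of players -/

/-- The sum of `⟪uᵢ - uⱼ, wᵢ - wⱼ⟫` over all ordered pairs `(i, j)`. -/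
noncomputable def pairInner (u w : Fin N → EuclideanSpace ℝ (Fin M)) : ℝ :=
  ∑ p : Fin N × Fin N, ⟪u p.1 - u p.2, w p.1 - w p.2⟫_ℝ

/-- The sum of `⟪uᵢ - uⱼ, wᵢ - wⱼ⟫` over all ordered pairs `(i, j)`, weighted with the
communication rates of the positions `x`. -/
noncomputable def ratePairInner (γ : ℝ) (x u w : Fin N → EuclideanSpace ℝ (Fin M)) : ℝ :=
  ∑ p : Fin N × Fin N, commRate γ (x p.1) (x p.2) * ⟪u p.1 - u p.2, w p.1 - w p.2⟫_ℝ

/-- The interaction potential of the configuration `x`, summed over all ordered pairs. -/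
noncomputable def pairPotential (γ : ℝ) (x : Fin N → EuclideanSpace ℝ (Fin M)) : ℝ :=
  ∑ p : Fin N × Fin N, ratePotential γ (‖x p.1 - x p.2‖ ^ 2)

lemma pairInner_comm (u w : Fin N → EuclideanSpace ℝ (Fin M)) :
    pairInner u w = pairInner w u :=
  Finset.sum_congr rfl fun _ _ => real_inner_comm _ _

lemma ratePairInner_comm (γ : ℝ) (x u w : Fin N → EuclideanSpace ℝ (Fin M)) :
    ratePairInner γ x u w = ratePairInner γ x w u :=
  Finset.sum_congr rfl fun _ _ => by rw [real_inner_comm]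

lemma norm_sub_sq_le_pairInner (u : Fin N → EuclideanSpace ℝ (Fin M)) (i j : Fin N) :
    ‖u i - u j‖ ^ 2 ≤ pairInner u u := by
  let f : Fin N × Fin N → ℝ := fun p => ⟪u p.1 - u p.2, u p.1 - u p.2⟫_ℝ
  have hf : ∀ p ∈ Finset.univ, 0 ≤ f p := fun _ _ => real_inner_self_nonneg
  have h : f (i, j) ≤ ∑ p, f p := Finset.single_le_sum hf (Finset.mem_univ (i, j))
  rw [← real_inner_self_eq_norm_sq]
  exact h

lemma pairInner_self_nonneg (u : Fin N → EuclideanSpace ℝ (Fin M)) : 0 ≤ pairInner u u :=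
  Finset.sum_nonneg fun _ _ => real_inner_self_nonneg

lemma ratePairInner_self_nonneg (γ : ℝ) (x u : Fin N → EuclideanSpace ℝ (Fin M)) :
    0 ≤ ratePairInner γ x u u :=
  Finset.sum_nonneg fun _ _ => mul_nonneg (commRate_pos _ _ _).le real_inner_self_nonneg

lemma mul_pairInner_self_le {γ c : ℝ} {x : Fin N → EuclideanSpace ℝ (Fin M)}
    (hc : ∀ i j, c ≤ commRate γ (x i) (x j)) (u : Fin N → EuclideanSpace ℝ (Fin M)) :
    c * pairInner u u ≤ ratePairInner γ x u u := by
  simp only [pairInner, ratePairInner, Finset.mul_sum]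
  exact Finset.sum_le_sum fun p _ =>
    mul_le_mul_of_nonneg_right (hc _ _) real_inner_self_nonneg

lemma abs_pairInner_le (u w : Fin N → EuclideanSpace ℝ (Fin M)) :
    |pairInner u w| ≤ (pairInner u u + pairInner w w) / 2 := by
  simp only [pairInner, ← Finset.sum_add_distrib, Finset.sum_div]
  refine (Finset.abs_sum_le_sum_abs _ _).trans (Finset.sum_le_sum fun p _ => ?_)
  simp only [real_inner_self_eq_norm_sq]
  have h := abs_real_inner_le_norm (u p.1 - u p.2) (w p.1 - w p.2)
  linarith [two_mul_le_add_sq ‖u p.1 - u p.2‖ ‖w p.1 - w p.2‖]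

/-- Young's inequality for the weighted pair sum. -/
lemma abs_mul_ratePairInner_le {γ : ℝ} (hγ : 0 ≤ γ) {a b : ℝ} (ha : 0 ≤ a) (hb : 0 < b)
    (x u w : Fin N → EuclideanSpace ℝ (Fin M)) :
    a * |ratePairInner γ x u w| ≤ b / 2 * pairInner u u + a ^ 2 / (2 * b) * pairInner w w := by
  simp only [pairInner, ratePairInner, Finset.mul_sum, ← Finset.sum_add_distrib]
  refine (mul_le_mul_of_nonneg_left (Finset.abs_sum_le_sum_abs _ _) ha).trans ?_
  rw [Finset.mul_sum]
  refine Finset.sum_le_sum fun p _ => ?_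
  simp only [real_inner_self_eq_norm_sq]
  have h := abs_real_inner_le_norm (u p.1 - u p.2) (w p.1 - w p.2)
  have hφ := commRate_pos γ (x p.1) (x p.2)
  have hφ' := commRate_le_one hγ (x p.1) (x p.2)
  set r := ‖u p.1 - u p.2‖
  set s := ‖w p.1 - w p.2‖
  have h1 : a * |commRate γ (x p.1) (x p.2) * ⟪u p.1 - u p.2, w p.1 - w p.2⟫_ℝ| ≤ a * (r * s) := by
    rw [abs_mul, abs_of_pos hφ]
    exact mul_le_mul_of_nonneg_left
      ((mul_le_of_le_one_left (abs_nonneg _) hφ').trans h) ha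
  refine h1.trans ?_
  have h2 : b / 2 * r ^ 2 + a ^ 2 / (2 * b) * s ^ 2 - a * (r * s)
      = (b * r - a * s) ^ 2 / (2 * b) := by
    field_simp
    ring
  have h3 : 0 ≤ (b * r - a * s) ^ 2 / (2 * b) := by positivity
  linarith

lemma pairPotential_nonneg (γ : ℝ) (x : Fin N → EuclideanSpace ℝ (Fin M)) :
    0 ≤ pairPotential γ x :=
  Finset.sum_nonneg fun _ _ => ratePotential_nonneg γ (sq_nonneg _)

lemma pairPotential_le {γ : ℝ} (hγ : 0 ≤ γ) (x : Fin N → EuclideanSpace ℝ (Fin M)) :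
    pairPotential γ x ≤ pairInner x x := by
  simp only [pairInner, real_inner_self_eq_norm_sq]
  exact Finset.sum_le_sum fun _ _ => ratePotential_le hγ (sq_nonneg _)

/-- Antisymmetric pairwise forces have zero mean, so that only the double sum remains. -/
lemma pairInner_sum_antisymm (u : Fin N → EuclideanSpace ℝ (Fin M))
    (g : Fin N → Fin N → EuclideanSpace ℝ (Fin M)) (hg : ∀ i j, g i j = -g j i) :
    pairInner u (fun i => ∑ k, g i k) =
      N * ∑ p : Fin N × Fin N, ⟪u p.1 - u p.2, g p.1 p.2⟫_ℝ := by
  have hzero : ∑ i, ∑ k, g i k = 0 := by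
    have h : ∑ i, ∑ k, g i k = -∑ i, ∑ k, g i k := by
      conv_lhs => rw [Finset.sum_comm]
      simp only [← Finset.sum_neg_distrib]
      exact Finset.sum_congr rfl fun i _ => Finset.sum_congr rfl fun k _ => hg k i
    have h2 : (2 : ℝ) • ∑ i, ∑ k, g i k = 0 := by
      rw [two_smul]
      exact eq_neg_iff_add_eq_zero.mp h
    exact (smul_eq_zero.mp h2).resolve_left two_ne_zero
  have hmean : ∀ y : EuclideanSpace ℝ (Fin M), ∑ i, ⟪y, ∑ k, g i k⟫_ℝ = 0 := fun y => by
    rw [← inner_sum, hzero, inner_zero_right]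
  have hswap : ∑ i, ∑ j, ⟪u j, g i j⟫_ℝ = -∑ i, ∑ j, ⟪u i, g i j⟫_ℝ := by
    rw [Finset.sum_comm]
    simp only [← Finset.sum_neg_distrib]
    refine Finset.sum_congr rfl fun i _ => Finset.sum_congr rfl fun k _ => ?_
    rw [hg k i, inner_neg_right]
  have hleft : pairInner u (fun i => ∑ k, g i k) = 2 * N * ∑ i, ∑ k, ⟪u i, g i k⟫_ℝ := by
    have h1 : ∑ i, ∑ j, ⟪u j, ∑ k, g i k⟫_ℝ = 0 := by
      rw [Finset.sum_comm]
      exact Finset.sum_eq_zero fun j _ => hmean _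
    simp only [pairInner, Fintype.sum_prod_type, inner_sub_left, inner_sub_right,
      Finset.sum_sub_distrib, hmean, h1]
    simp [inner_sum, ← Finset.mul_sum]
    ring
  rw [hleft, Fintype.sum_prod_type]
  simp only [inner_sub_left, Finset.sum_sub_distrib, hswap]
  ring

/-- The work of the force against any configuration, in terms of differences only. -/
lemma pairInner_centralizedForce (γ lx lv lw : ℝ)
    (x v u : Fin N → EuclideanSpace ℝ (Fin M)) :
    pairInner u (centralizedForce γ lx lv lw x v) =
      -lx * ratePairInner γ x u x - lv * ratePairInner γ x u v - lw * pairInner u x := by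
  rcases Nat.eq_zero_or_pos N with rfl | hN
  · simp [pairInner, ratePairInner]
  have hN' : (N : ℝ) ≠ 0 := by exact_mod_cast hN.ne'
  let g : Fin N → Fin N → EuclideanSpace ℝ (Fin M) := fun i j =>
    (lx / N) • commRate γ (x i) (x j) • (x j - x i)
      + (lv / N) • commRate γ (x i) (x j) • (v j - v i)
  have hg : ∀ i j, g i j = -g j i := fun i j => by
    simp only [g, commRate_symm γ (x j) (x i)]
    module
  have hF : ∀ i, centralizedForce γ lx lv lw x v i = (∑ k, g i k) - lw • x i := fun i => by
    simp only [centralizedForce, g, Finset.sum_add_distrib, Finset.smul_sum]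
  have h1 : pairInner u (centralizedForce γ lx lv lw x v) =
      pairInner u (fun i => ∑ k, g i k) - lw * pairInner u x := by
    simp only [pairInner, hF, Finset.mul_sum, ← Finset.sum_sub_distrib]
    refine Finset.sum_congr rfl fun p _ => ?_
    simp only [Finset.sum_sub_distrib, inner_sub_right, real_inner_smul_right]
    ring
  rw [h1, pairInner_sum_antisymm u g hg]
  simp only [ratePairInner, Finset.mul_sum, ← Finset.sum_sub_distrib]
  congr 1
  refine Finset.sum_congr rfl fun p _ => ?_
  simp only [g, inner_add_right, real_inner_smul_right, inner_sub_right]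
  field_simp
  ring

/-! ### Derivatives along a solution -/

lemma hasDerivWithinAt_pairInner {x w : ℝ → Fin N → EuclideanSpace ℝ (Fin M)}
    {x' w' : Fin N → EuclideanSpace ℝ (Fin M)} {s : Set ℝ} {t : ℝ}
    (hx : ∀ i, HasDerivWithinAt (fun r => x r i) (x' i) s t)
    (hw : ∀ i, HasDerivWithinAt (fun r => w r i) (w' i) s t) :
    HasDerivWithinAt (fun r => pairInner (x r) (w r))
      (pairInner (x t) w' + pairInner x' (w t)) s t := by
  simp only [pairInner, ← Finset.sum_add_distrib]
  exact HasDerivWithinAt.fun_sum fun p _ =>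
    ((hx p.1).sub (hx p.2)).inner ℝ ((hw p.1).sub (hw p.2))

lemma hasDerivWithinAt_pairPotential (γ : ℝ) {x : ℝ → Fin N → EuclideanSpace ℝ (Fin M)}
    {x' : Fin N → EuclideanSpace ℝ (Fin M)} {s : Set ℝ} {t : ℝ}
    (hx : ∀ i, HasDerivWithinAt (fun r => x r i) (x' i) s t) :
    HasDerivWithinAt (fun r => pairPotential γ (x r)) (2 * ratePairInner γ (x t) (x t) x') s t := by
  simp only [pairPotential, ratePairInner, Finset.mul_sum]
  refine HasDerivWithinAt.fun_sum fun p _ => ?_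
  have h := (hasDerivAt_ratePotential γ (‖x t p.1 - x t p.2‖ ^ 2)).comp_hasDerivWithinAt t
    ((hx p.1).sub (hx p.2)).norm_sq
  refine h.congr_deriv ?_
  rw [commRate_eq_rateProfile]
  simp only [Pi.sub_apply]
  ring

/-- The energy of the differences, summed over all ordered pairs. -/
noncomputable def energy (γ lx lw : ℝ) (x v : Fin N → EuclideanSpace ℝ (Fin M)) : ℝ :=
  pairInner v v + lx * pairPotential γ x + lw * pairInner x x

variable {γ lx lv lw : ℝ} {x v : ℝ → Fin N → EuclideanSpace ℝ (Fin M)}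

/-- The energy is dissipated by the velocity alignment alone. -/
lemma hasDerivWithinAt_energy (hsol : IsCentralizedSolution γ lx lv lw x v) {t : ℝ} (ht : 0 ≤ t) :
    HasDerivWithinAt (fun s => energy γ lx lw (x s) (v s))
      (-2 * lv * ratePairInner γ (x t) (v t) (v t)) (Set.Ici 0) t := by
  have hx := hsol.position t ht
  have hv := hsol.velocity t ht
  refine (((hasDerivWithinAt_pairInner hv hv).add
    ((hasDerivWithinAt_pairPotential γ hx).const_mul lx)).add
    ((hasDerivWithinAt_pairInner hx hx).const_mul lw)).congr_deriv ?_
  rw [pairInner_comm (centralizedForce γ lx lv lw (x t) (v t)) (v t),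
    pairInner_centralizedForce, pairInner_comm (x t) (v t),
    ratePairInner_comm γ (x t) (x t) (v t)]
  ring

lemma hasDerivWithinAt_cross (hsol : IsCentralizedSolution γ lx lv lw x v) {t : ℝ} (ht : 0 ≤ t) :
    HasDerivWithinAt (fun s => pairInner (x s) (v s))
      (pairInner (v t) (v t) - lx * ratePairInner γ (x t) (x t) (x t)
        - lv * ratePairInner γ (x t) (x t) (v t) - lw * pairInner (x t) (x t)) (Set.Ici 0) t := by
  refine (hasDerivWithinAt_pairInner (hsol.position t ht) (hsol.velocity t ht)).congr_deriv ?_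
  rw [pairInner_centralizedForce]
  ring

/-- A differential form of Grönwall's inequality on `[0, ∞)`, with exponential decay. -/
lemma le_mul_exp_of_hasDerivWithinAt_le {L L' : ℝ → ℝ} {κ : ℝ}
    (hL : ∀ t, 0 ≤ t → HasDerivWithinAt L (L' t) (Set.Ici 0) t)
    (hle : ∀ t, 0 ≤ t → L' t ≤ -κ * L t) {t : ℝ} (ht : 0 ≤ t) :
    L t ≤ L 0 * Real.exp (-κ * t) := by
  have hexp : ∀ r : ℝ, HasDerivAt (fun s => Real.exp (κ * s)) (Real.exp (κ * r) * κ) r :=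
    fun r => by simpa using ((hasDerivAt_id r).const_mul κ).exp
  have hd : ∀ r, 0 ≤ r → HasDerivWithinAt (fun s => L s * Real.exp (κ * s))
      (L' r * Real.exp (κ * r) + L r * (Real.exp (κ * r) * κ)) (Set.Ici 0) r :=
    fun r hr => (hL r hr).mul (hexp r).hasDerivWithinAt
  have hanti : AntitoneOn (fun s => L s * Real.exp (κ * s)) (Set.Ici 0) := by
    refine antitoneOn_of_hasDerivWithinAt_nonpos (convex_Ici 0)
      (fun r hr => (hd r hr).continuousWithinAt)
      (fun r hr => (hd r (interior_subset hr)).mono interior_subset) fun r hr => ?_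
    have h1 := hle r (interior_subset hr)
    have h2 : (L' r + κ * L r) * Real.exp (κ * r) ≤ 0 :=
      mul_nonpos_of_nonpos_of_nonneg (by linarith) (Real.exp_pos _).le
    linarith
  have h := hanti (Set.mem_Ici.2 le_rfl) (Set.mem_Ici.2 ht) ht
  simp only [mul_zero, Real.exp_zero, mul_one] at h
  rw [neg_mul, Real.exp_neg, ← div_eq_mul_inv, le_div_iff₀ (Real.exp_pos _)]
  exact h

/-! ### Exponential decay of the differences -/

lemma energy_le_energy_zero (hlv : 0 ≤ lv) (hsol : IsCentralizedSolution γ lx lv lw x v)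
    {t : ℝ} (ht : 0 ≤ t) : energy γ lx lw (x t) (v t) ≤ energy γ lx lw (x 0) (v 0) := by
  have h := le_mul_exp_of_hasDerivWithinAt_le (κ := 0)
    (fun t ht => hasDerivWithinAt_energy hsol ht) (fun r _ => ?_) ht
  · simpa using h
  · have := mul_nonneg hlv (ratePairInner_self_nonneg γ (x r) (v r))
    linarith

lemma mul_pairInner_le_energy (hlx : 0 ≤ lx) (y w : Fin N → EuclideanSpace ℝ (Fin M)) :
    lw * pairInner y y ≤ energy γ lx lw y w := by
  have h1 := pairInner_self_nonneg w
  have h2 := mul_nonneg hlx (pairPotential_nonneg γ y)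
  unfold energy
  linarith

/-- Along a solution the communication rates stay above a positive constant. -/
lemma exists_pos_le_commRate_solution (hγ : 0 ≤ γ) (hlx : 0 ≤ lx) (hlv : 0 ≤ lv) (hlw : 0 < lw)
    (hsol : IsCentralizedSolution γ lx lv lw x v) :
    ∃ c, 0 < c ∧ ∀ t, 0 ≤ t → ∀ i j, c ≤ commRate γ (x t i) (x t j) := by
  have hbound : ∀ t, 0 ≤ t → pairInner (x t) (x t) ≤ energy γ lx lw (x 0) (v 0) / lw :=
    fun t ht => by
      rw [le_div_iff₀ hlw, mul_comm]
      exact (mul_pairInner_le_energy hlx _ _).trans (energy_le_energy_zero hlv hsol ht)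
  obtain ⟨c, hc, h⟩ := exists_pos_le_commRate (M := M) hγ
    ((pairInner_self_nonneg (x 0)).trans (hbound 0 le_rfl))
  exact ⟨c, hc, fun t ht i j => h _ _ ((norm_sub_sq_le_pairInner _ i j).trans (hbound t ht))⟩

theorem exists_pairInner_le_exp (hγ : 0 ≤ γ) (hlx : 0 ≤ lx) (hlv : 0 < lv) (hlw : 0 < lw)
    (hsol : IsCentralizedSolution γ lx lv lw x v) :
    ∃ C κ : ℝ, 0 < κ ∧ ∀ t, 0 ≤ t →
      pairInner (x t) (x t) + pairInner (v t) (v t) ≤ C * Real.exp (-κ * t) := by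
  obtain ⟨c, hc, hrate⟩ := exists_pos_le_commRate_solution hγ hlx hlv.le hlw hsol
  set A : ℝ := 1 + lv ^ 2 / (2 * lw) with hA
  have hA0 : 0 < A := by positivity
  -- `ε ≤ 1` and `ε ≤ lw` keep `L` positive definite; `ε A ≤ lv c` lets half of the dissipation of
  -- the energy absorb the positive part of the derivative of the cross term.
  obtain ⟨ε, hε, hε1, hεw, hεA⟩ : ∃ ε : ℝ, 0 < ε ∧ ε ≤ 1 ∧ ε ≤ lw ∧ ε * A ≤ lv * c :=
    ⟨min (min 1 lw) (lv * c / A), by positivity, (min_le_left _ _).trans (min_le_left _ _),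
      (min_le_left _ _).trans (min_le_right _ _), (le_div_iff₀ hA0).1 (min_le_right _ _)⟩
  set m : ℝ := min 1 lw / 2 with hm
  have hm0 : 0 < m := by positivity
  set K : ℝ := 2 + lx + lw with hK
  have hK0 : 0 < K := by positivity
  set δ : ℝ := min (lv * c) (ε * (lw / 2)) with hδ
  have hδ0 : 0 < δ := by positivity
  let L : ℝ → ℝ := fun t => energy γ lx lw (x t) (v t) + ε * pairInner (x t) (v t)
  have hL := fun t (ht : 0 ≤ t) =>
    (hasDerivWithinAt_energy hsol ht).add ((hasDerivWithinAt_cross hsol ht).const_mul ε)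
  have hlower : ∀ t, m * (pairInner (x t) (x t) + pairInner (v t) (v t)) ≤ L t := fun t => by
    have hX := pairInner_self_nonneg (x t)
    have hV := pairInner_self_nonneg (v t)
    have hP := mul_nonneg hlx (pairPotential_nonneg γ (x t))
    have hD := mul_le_mul_of_nonneg_left (abs_le.1 (abs_pairInner_le (x t) (v t))).1 hε.le
    have h1 := mul_le_mul_of_nonneg_right hε1 hV
    have h2 := mul_le_mul_of_nonneg_right hεw hX
    have h3 := mul_le_mul_of_nonneg_right (min_le_left 1 lw) hV
    have h4 := mul_le_mul_of_nonneg_right (min_le_right 1 lw) hX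
    simp only [L, energy, hm]
    linarith
  have hupper : ∀ t, L t ≤ K * (pairInner (x t) (x t) + pairInner (v t) (v t)) := fun t => by
    have hX := pairInner_self_nonneg (x t)
    have hV := pairInner_self_nonneg (v t)
    have hP := mul_le_mul_of_nonneg_left (pairPotential_le hγ (x t)) hlx
    have hD := mul_le_mul_of_nonneg_left (abs_le.1 (abs_pairInner_le (x t) (v t))).2 hε.le
    have h1 := mul_le_mul_of_nonneg_right hε1 hV
    have h2 := mul_le_mul_of_nonneg_right hε1 hX
    have h3 := mul_nonneg hlx hV
    have h4 := mul_nonneg hlw.le hV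
    simp only [L, energy, hK]
    linarith
  have hdecay := fun t (ht : 0 ≤ t) =>
    le_mul_exp_of_hasDerivWithinAt_le (κ := δ / K) hL (fun t ht => ?_) ht
  · refine ⟨L 0 / m, δ / K, by positivity, fun t ht => ?_⟩
    rw [div_mul_eq_mul_div, le_div_iff₀ hm0, mul_comm]
    exact (hlower t).trans (hdecay t ht)
  · change _ ≤ -(δ / K) * L t
    have hX := pairInner_self_nonneg (x t)
    have hV := pairInner_self_nonneg (v t)
    have hdiss := mul_le_mul_of_nonneg_left (mul_pairInner_self_le (hrate t ht) (v t)) hlv.le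
    have hself := mul_nonneg hlx (ratePairInner_self_nonneg γ (x t) (x t))
    have hyoung := abs_mul_ratePairInner_le hγ hlv.le hlw (x t) (x t) (v t)
    have habs := mul_le_mul_of_nonneg_left (neg_abs_le (ratePairInner γ (x t) (x t) (v t))) hlv.le
    have hcross : pairInner (v t) (v t) - lx * ratePairInner γ (x t) (x t) (x t)
        - lv * ratePairInner γ (x t) (x t) (v t) - lw * pairInner (x t) (x t)
        ≤ A * pairInner (v t) (v t) - lw / 2 * pairInner (x t) (x t) := by
      rw [hA]
      linarith
    have h1 := mul_le_mul_of_nonneg_left hcross hε.le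
    have h2 := mul_le_mul_of_nonneg_right hεA hV
    have h3 := mul_le_mul_of_nonneg_right (min_le_left (lv * c) (ε * (lw / 2))) hV
    have h4 := mul_le_mul_of_nonneg_right (min_le_right (lv * c) (ε * (lw / 2))) hX
    have h5 : δ / K * L t ≤ δ * (pairInner (x t) (x t) + pairInner (v t) (v t)) := by
      rw [div_mul_eq_mul_div, div_le_iff₀ hK0, mul_assoc, mul_comm _ K]
      exact mul_le_mul_of_nonneg_left (hupper t) hδ0.le
    rw [← hδ] at h3 h4
    linarith

lemma tendsto_norm_sub_of_pairInner_le {u : ℝ → Fin N → EuclideanSpace ℝ (Fin M)} {f : ℝ → ℝ}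
    (hf : Tendsto f atTop (𝓝 0)) (h : ∀ t, 0 ≤ t → pairInner (u t) (u t) ≤ f t) (i j : Fin N) :
    Tendsto (fun t => ‖u t i - u t j‖) atTop (𝓝 0) := by
  have hsqrt : Tendsto (fun t => √(f t)) atTop (𝓝 0) := by
    simpa using hf.sqrt
  refine squeeze_zero' (Eventually.of_forall fun t => norm_nonneg _) ?_ hsqrt
  filter_upwards [eventually_ge_atTop (0 : ℝ)] with t ht
  exact Real.le_sqrt_of_sq_le ((norm_sub_sq_le_pairInner _ i j).trans (h t ht))

end HerdingModel

theorem corollary3p8 {N M : ℕ} (γ lx lv lw : ℝ)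
    (hγ : 0 < γ) (hlx : 0 < lx) (hlv : 0 < lv) (hlw : 0 < lw)
    (x v : ℝ → Fin N → EuclideanSpace ℝ (Fin M))
    (hsol : HerdingModel.IsCentralizedSolution γ lx lv lw x v) :
    HerdingModel.HerdingOccurs x v := by
  obtain ⟨C, κ, hκ, h⟩ := HerdingModel.exists_pairInner_le_exp hγ.le hlx.le hlv hlw hsol
  have hlim : Tendsto (fun t => C * Real.exp (-κ * t)) atTop (𝓝 0) := by
    have hlin : Tendsto (fun t : ℝ => -κ * t) atTop atBot :=
      tendsto_id.const_mul_atTop_of_neg (neg_neg_of_pos hκ)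
    simpa using (Real.tendsto_exp_atBot.comp hlin).const_mul C
  refine fun i j => ⟨HerdingModel.tendsto_norm_sub_of_pairInner_le hlim (fun t ht => ?_) i j,
    HerdingModel.tendsto_norm_sub_of_pairInner_le hlim (fun t ht => ?_) i j⟩
  · linarith [h t ht, HerdingModel.pairInner_self_nonneg (v t)]
  · linarith [h t ht, HerdingModel.pairInner_self_nonneg (x t)]
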